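/- Let $\mathcal A$ be an arrangement of hyperplanes $H_k=\{z\in\mathbb C^d:\ell_k(z)=0\}$, $k=1,\dots,t$, given by nonzero complex linear forms $\ell_k$ on $\mathbb C^d$, and assume that it is essential: $\bigcap_k H_k=\{0\}$. Let $\sigma(z)\in\{0,+,-,i,j\}^t$ be the sign vector of $z\in\mathbb C^d$: $\sigma(z)_k$ is $0$ if $\ell_k(z)=0$; it is $+$ or $-$ if $\ell_k(z)$ is a positive or negative real number, respectively; and it is $i$ or $j$ if $\operatorname{Im}\ell_k(z)$ is positive or negative, respectively. Let $F_{\mathcal A}=\sigma(\mathbb C^d)$, ordered componentwise by $0<+,-<i,j$ (the signs $+,-$ are incomparable, the signs $i,j$ are incomparable, and $i$ and $j$ each lie above both $+$ and $-$). Composition of sign vectors is given by $(Z\circ W)_k=W_k$ if $W_k>Z_k$, and $(Z\circ W)_k=Z_k$ otherwise. Put $H_k^{\mathbb R}=\{z:\operatorname{Im}\ell_k(z)=0\}$. Let $L_{\mathrm{aug}}$ be the lattice of all intersections of subfamilies of $\{H_1,\dots,H_t,H_1^{\mathbb R},\dots,H_t^{\mathbb R}\}$, ordered by inclusion, with top element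 $\hat 1=\mathbb C^d$ (the empty intersection) and Möbius function $\mu$. For $F\in F_{\mathcal A}$ let $\mathrm{span}(F)\in L_{\mathrm{aug}}$ be the intersection of all $H_k$ and $H_k^{\mathbb R}$ that contain $\sigma^{-1}(F)$. Let $w$ be a probability distribution on $F_{\mathcal A}$, and let $P_w(C,D)=\sum_{F\in F_{\mathcal A}:\,F\circ C=D}w_F$, for $C,D\in\max(F_{\mathcal A})$, be the transition matrix of the walk on the maximal sign vectors that moves from $C$ to $F\circ C$ with $F$ chosen according to $w$. For $X\in L_{\mathrm{aug}}$ put $\varepsilon_X=\sum_{F:\,\mathrm{span}(F)\subseteq X}w_F$. Then: 1. $P_w$ is diagonalizable over $\mathbb R$. 2. For each $X\in L_{\mathrm{aug}}$ with $\mu(X,\hat 1)\ne 0$, the number $\varepsilon_X$ is an eigenvalue of $P_w$. 3. The multiplicity of $\varepsilon_X$ is $|\mu(X,\hat 1)|$, where multiplicities add up when several $\varepsilon_X$ coincide; that is, the characteristic polynomial of $P_w$ is $\prod_{X\in L_{\mathrm{aug}}}(x-\varepsilon_X)^{|\mu(X,\hat 1)|}$. 4. These are all the (complex) eigenvalues of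 $P_w$. 5. Suppose that $w$ is not concentrated on any single real hyperplane $H_k^{\mathbb R}$, i.e. for each $k$ there is $F\in F_{\mathcal A}$ with $w_F>0$ and $\sigma^{-1}(F)\not\subseteq H_k^{\mathbb R}$. Then there is a unique probability distribution $\pi$ on $\max(F_{\mathcal A})$ with $\pi P_w=\pi$. -/

import Mathlib

/-- The five signs `0, +, -, i, j`. -/
inductive CSign
  | zero
  | pos
  | neg
  | i
  | j
  deriving DecidableEq

namespace CSign

instance : Fintype CSign where
  elems := {zero, pos, neg, i, j}
  complete x := by cases x <;> simp

/-- The level of a sign in the Hasse diagram `0 < +, - < i, j`. -/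
def level : CSign → ℕ
  | zero => 0
  | pos => 1
  | neg => 1
  | i => 2
  | j => 2

/-- The order in which `0` is the least sign, `+` and `-` are incomparable and both lie above `0`,
and `i` and `j` are incomparable and both lie above each of `+` and `-`. -/
instance : PartialOrder CSign where
  le x y := x = y ∨ x.level < y.level
  le_refl x := Or.inl rfl
  le_trans x y z := by
    rintro (rfl | h) (rfl | h')
    · exact Or.inl rfl
    · exact Or.inr h'
    · exact Or.inr h
    · exact Or.inr (h.trans h')
  le_antisymm x y := by
    rintro (rfl | h) (h' | h')
    · rfl
    · rfl
    · exact h'.symm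
    · exact absurd h' h.asymm

open Classical in
/-- The sign of a complex number. -/
noncomputable def ofComplex (c : ℂ) : CSign :=
  if 0 < c.im then i
  else if c.im < 0 then j
  else if 0 < c.re then pos
  else if c.re < 0 then neg
  else zero

open Classical in
/-- Composition of complex sign vectors. -/
noncomputable def comp {t : ℕ} (Z W : Fin t → CSign) : Fin t → CSign :=
  fun k => if Z k < W k then W k else Z k

end CSign

/-- A complex hyperplane arrangement in `ℂ^d`, given by a choice of `t` defining linear forms.
Each form is nonzero, so that its kernel is a hyperplane. -/
structure CArrangement (d t : ℕ) where
  form : Fin t → Module.Dual ℂ (Fin d → ℂ)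
  form_ne_zero : ∀ k, form k ≠ 0

namespace CArrangement

variable {d t : ℕ} (A : CArrangement d t)

/-- The hyperplane `H_k`, as a real subspace of `ℂ^d`. -/
noncomputable def hyperplane (k : Fin t) : Submodule ℝ (Fin d → ℂ) :=
  (LinearMap.ker (A.form k)).restrictScalars ℝ

/-- The real hyperplane `H_k^ℝ = {z | Im (ℓ_k z) = 0}` of `ℂ^d`. -/
noncomputable def realHyperplane (k : Fin t) : Submodule ℝ (Fin d → ℂ) :=
  LinearMap.ker (Complex.imLm ∘ₗ (A.form k).restrictScalars ℝ)

/-- The hyperplanes `H_k` intersect in the origin only. -/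
def Essential : Prop :=
  ⨅ k, A.hyperplane k = ⊥

/-- The augmented arrangement. -/
def augmented : Set (Submodule ℝ (Fin d → ℂ)) :=
  Set.range A.hyperplane ∪ Set.range A.realHyperplane

/-- The augmented intersection lattice: all intersections of subfamilies of the augmented
arrangement, ordered by inclusion. The empty intersection is the whole space. -/
abbrev AugLattice : Type :=
  {X : Submodule ℝ (Fin d → ℂ) // ∃ S ⊆ A.augmented, X = sInf S}

theorem augmented_finite : A.augmented.Finite :=
  (Set.finite_range _).union (Set.finite_range _)

instance : Finite A.AugLattice := by
  have h : (sInf '' A.augmented.powerset).Finite := A.augmented_finite.finite_subsets.image _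
  refine (h.subset ?_).to_subtype (s := {X | ∃ S ⊆ A.augmented, X = sInf S})
  rintro X ⟨S, hS, rfl⟩
  exact ⟨S, hS, rfl⟩

noncomputable instance : Fintype A.AugLattice := Fintype.ofFinite _

noncomputable instance : DecidableEq A.AugLattice := Classical.decEq _

open Classical in
noncomputable instance : LocallyFiniteOrder A.AugLattice := Fintype.toLocallyFiniteOrder

/-- The top element of the augmented intersection lattice is the whole space. -/
noncomputable instance : OrderTop A.AugLattice where
  top := ⟨⊤, ∅, Set.empty_subset _, sInf_empty.symm⟩
  le_top X := (le_top : X.1 ≤ ⊤)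

/-- The value `μ(X, 1̂)` of the Möbius function of the augmented intersection lattice. -/
noncomputable def muTop (X : A.AugLattice) : ℤ :=
  IncidenceAlgebra.mu ℤ X ⊤

/-- The sign vector of a point of `ℂ^d`. -/
noncomputable def sign (z : Fin d → ℂ) : Fin t → CSign :=
  fun k => CSign.ofComplex (A.form k z)

/-- The face poset `F_A`: all sign vectors of points, with the componentwise order. -/
abbrev Face : Type :=
  {Z : Fin t → CSign // Z ∈ Set.range A.sign}

noncomputable instance : Fintype A.Face := Fintype.ofFinite _

/-- The maximal elements of the face poset. -/
abbrev MaxFace : Type :=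
  {C : A.Face // IsMax C}

noncomputable instance : Fintype A.MaxFace := Fintype.ofFinite _

/-- The convex cone of all points with a given sign vector. -/
def cone (F : A.Face) : Set (Fin d → ℂ) :=
  {z | A.sign z = F.1}

/-- The span map: the intersection of all members of the augmented arrangement that contain
the cone of `F`. -/
noncomputable def span (F : A.Face) : A.AugLattice :=
  ⟨sInf {H | H ∈ A.augmented ∧ A.cone F ⊆ H}, _, fun _ h => h.1, rfl⟩

open Classical in
/-- The transition matrix `P_w(C, D) = ∑_{F : F ∘ C = D} w_F` on the maximal sign vectors. -/
noncomputable def transition (w : A.Face → ℝ) : Matrix A.MaxFace A.MaxFace ℝ :=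
  Matrix.of fun C D => ∑ F : A.Face with CSign.comp F.1 C.1.1 = D.1.1, w F

open Classical in
/-- `ε_X = ∑_{F : span F ⊆ X} w_F`. -/
noncomputable def eps (w : A.Face → ℝ) (X : A.AugLattice) : ℝ :=
  ∑ F : A.Face with A.span F ≤ X, w F

/-- All the mass of `w` lies on faces whose cone is contained in `H`. -/
def ConcentratedOn (w : A.Face → ℝ) (H : Submodule ℝ (Fin d → ℂ)) : Prop :=
  ∀ F : A.Face, w F ≠ 0 → A.cone F ⊆ H

end CArrangement

/-! Faces form a monoid acting on the maximal faces by left composition. Composition takes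
coordinatewise maxima of levels, so `span` turns it into a join: span(F∘G) ≤ X iff span F ≤ X and
span G ≤ X, and F∘G = F when span G ≤ span F. Thus F ↦ [span F ≤ X] is multiplicative, and P_w^k is
the walk of a weight whose value of ε_X is ε_X^k.

The trace of the matrix of F counts the maximal faces fixed by F. These are the chambers cut out by
the real hyperplanes containing span F, and Zaslavsky's theorem counts them as ∑ |μ(Y, 1̂)| over Y ≥
span F. By linearity tr P_w^k = ∑_X |μ(X, 1̂)| ε_X^k for all k.

For diagonalizability, multiply the matrix of F by P_w - ε_{span F}: the absorbed faces cancel,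
leaving matrices of F∘G with strictly larger ε. Iterating from the identity, P_w is killed by a
product of distinct linear factors. The power sums then identify the diagonal entries, hence the
characteristic polynomial. Without concentration, ε_X = 1 only for X = 1̂, where μ = 1; so 1 is a
simple eigenvalue and the stationary law is unique. -/

/-! ### Linear algebra: diagonalization, power sums, stationary vectors -/

open Polynomial in
-- Split off one factor X - a and let g be the rest. Then g v is an a-eigenvector on which g acts by
-- the nonzero scalar c = ∏ (a - b), so g kills v - c⁻¹ g v and induction applies to that vector.
theorem Module.End.mem_span_eigenvectors_of_aeval_prod_eq_zero {K V : Type*} [Field K]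
    [AddCommGroup V] [Module K V] (f : Module.End K V) (s : Finset K) (v : V)
    (h : aeval f (∏ a ∈ s, (X - C a)) v = 0) :
    v ∈ Submodule.span K {v : V | ∃ c : K, f v = c • v} := by
  classical
  induction s using Finset.induction_on generalizing v with
  | empty => simp at h; simp [h]
  | insert a s ha ih =>
    rw [Finset.prod_insert ha, map_mul, Module.End.mul_apply] at h
    set g := aeval f (∏ a ∈ s, (X - C a)) with hg
    have h1 : f (g v) = a • g v := by
      simpa [sub_eq_zero, Module.algebraMap_end_apply] using h
    have hk : g (g v) = (∏ b ∈ s, (a - b)) • g v := by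
      have := Module.End.aeval_apply_of_mem_apply_eq_smul (p := ∏ a ∈ s, (X - C a)) h1
      simpa [Polynomial.eval_prod] using this
    have hk0 : (∏ b ∈ s, (a - b)) ≠ 0 :=
      Finset.prod_ne_zero_iff.2 fun b hb => sub_ne_zero.2 fun hab => ha (hab ▸ hb)
    have h2 : v - (∏ b ∈ s, (a - b))⁻¹ • g v ∈
        Submodule.span K {v : V | ∃ c : K, f v = c • v} := by
      apply ih
      rw [map_sub, map_smul, hk, smul_smul, inv_mul_cancel₀ hk0, one_smul, sub_self]
    have h3 : g v ∈ Submodule.span K {v : V | ∃ c : K, f v = c • v} :=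
      Submodule.subset_span ⟨a, h1⟩
    simpa using Submodule.add_mem _ h2 (Submodule.smul_mem _ (∏ b ∈ s, (a - b))⁻¹ h3)

open Polynomial in
/-- A matrix annihilated by a product of distinct linear factors is diagonalizable. -/
theorem Matrix.exists_eq_conj_diagonal_of_aeval_prod_eq_zero {K n : Type*} [Field K] [Fintype n]
    [DecidableEq n] (M : Matrix n n K) (s : Finset K)
    (h : aeval M (∏ a ∈ s, (X - C a)) = 0) :
    ∃ (Q : (Matrix n n K)ˣ) (D : n → K),
      M = (Q : Matrix n n K) * Matrix.diagonal D * ((Q⁻¹ : (Matrix n n K)ˣ) : Matrix n n K) := by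
  set f : Module.End K (n → K) := Matrix.toLin' M with hf
  have h0 : aeval f (∏ a ∈ s, (X - C a)) = 0 := by
    have := Polynomial.aeval_algHom_apply (Matrix.toLinAlgEquiv' (R := K) (n := n)).toAlgHom M
      (∏ a ∈ s, (X - C a))
    rw [h, map_zero] at this
    exact this
  have hspan : ⊤ ≤ Submodule.span K {v : n → K | ∃ c : K, f v = c • v} := fun v _ =>
    f.mem_span_eigenvectors_of_aeval_prod_eq_zero s v (by rw [h0]; rfl)
  let b := Module.Basis.ofSpan hspan
  have hb : ∀ i, ∃ c : K, f (b i) = c • b i := fun i =>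
    Module.Basis.ofSpan_subset hspan ⟨i, rfl⟩
  let e := b.indexEquiv (Pi.basisFun K n)
  let b' := b.reindex e
  have hb' : ∀ i, ∃ c : K, f (b' i) = c • b' i := fun i => by
    simpa [b'] using hb (e.symm i)
  choose D hD using hb'
  let P := Pi.basisFun K n
  refine ⟨⟨P.toMatrix b', b'.toMatrix P, P.toMatrix_mul_toMatrix_flip b',
    b'.toMatrix_mul_toMatrix_flip P⟩, D, ?_⟩
  have : M * P.toMatrix b' = P.toMatrix b' * Matrix.diagonal D := by
    ext i j
    have := congrFun (hD j) i
    simp only [hf, Matrix.toLin'_apply, Matrix.mulVec, dotProduct, Pi.smul_apply,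
      smul_eq_mul] at this
    simp [Matrix.mul_apply, P, Module.Basis.toMatrix_apply, this, Matrix.diagonal, mul_comm]
  change M = P.toMatrix b' * Matrix.diagonal D * b'.toMatrix P
  rw [← this, Matrix.mul_assoc, P.toMatrix_mul_toMatrix_flip b', Matrix.mul_one]

open Polynomial in
/-- Power sums with natural number weights determine the weights. -/
theorem card_filter_eq_sum_of_sum_pow_eq {K n ι : Type*} [Field K] [CharZero K] [DecidableEq K]
    [Fintype n] [Fintype ι] {D : n → K} {e : ι → K} {m : ι → ℕ}
    (h : ∀ k : ℕ, ∑ c, D c ^ k = ∑ i, (m i : K) * e i ^ k) (a : K) :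
    (Finset.univ.filter fun c => D c = a).card = ∑ i with e i = a, m i := by
  -- Equality on powers extends linearly to all polynomials; the Lagrange polynomial that is 1 at a
  -- and 0 at the other values isolates a.
  have hp : ∀ p : K[X], ∑ c, p.eval (D c) = ∑ i, (m i : K) * p.eval (e i) := by
    intro p
    simp only [Polynomial.eval_eq_sum_range, Finset.mul_sum]
    rw [Finset.sum_comm, Finset.sum_comm (s := (Finset.univ : Finset ι))]
    refine Finset.sum_congr rfl fun k _ => ?_
    rw [← Finset.mul_sum, h, Finset.mul_sum]
    exact Finset.sum_congr rfl fun i _ => by ring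
  let s : Finset K := insert a (Finset.univ.image D ∪ Finset.univ.image e)
  have ha : a ∈ s := Finset.mem_insert_self _ _
  have hv : ∀ b ∈ s, (Lagrange.basis s id a).eval b = if b = a then 1 else 0 := by
    intro b hb
    split_ifs with hab
    · subst hab
      exact Lagrange.eval_basis_self (v := id) (fun _ _ _ _ h => h) hb
    · exact Lagrange.eval_basis_of_ne (v := id) (Ne.symm hab) hb
  have h1 := hp (Lagrange.basis s id a)
  have h2 : ∀ c, (Lagrange.basis s id a).eval (D c) = if D c = a then 1 else 0 :=
    fun c => hv (D c) (by simp [s])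
  have h3 : ∀ i, (Lagrange.basis s id a).eval (e i) = if e i = a then 1 else 0 :=
    fun i => hv (e i) (by simp [s])
  simp only [h2, h3] at h1
  simp only [mul_ite, mul_one, mul_zero, Finset.sum_ite, Finset.sum_const_zero, add_zero,
    Finset.sum_const, nsmul_eq_mul] at h1
  exact_mod_cast h1

open Polynomial in
/-- Power sums with natural number weights determine the corresponding monic split polynomial. -/
theorem Polynomial.prod_X_sub_C_eq_of_sum_pow_eq {K n ι : Type*} [Field K] [CharZero K]
    [Fintype n] [Fintype ι] {D : n → K} {e : ι → K} {m : ι → ℕ}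
    (h : ∀ k : ℕ, ∑ c, D c ^ k = ∑ i, (m i : K) * e i ^ k) :
    ∏ c, (X - C (D c)) = ∏ i, (X - C (e i)) ^ m i := by
  classical
  let s : Finset K := Finset.univ.image D ∪ Finset.univ.image e
  rw [← Finset.prod_fiberwise_of_maps_to (s := Finset.univ) (t := s) (g := D)
      (fun c _ => by simp [s]),
    ← Finset.prod_fiberwise_of_maps_to (s := Finset.univ) (t := s) (g := e)
      (fun c _ => by simp [s])]
  refine Finset.prod_congr rfl fun a ha => ?_
  rw [Finset.prod_congr rfl (g := fun _ => X - C a) fun c hc => by rw [(Finset.mem_filter.1 hc).2],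
    Finset.prod_const, card_filter_eq_sum_of_sum_pow_eq h a,
    Finset.prod_congr rfl (g := fun i => (X - C a) ^ m i)
      fun c hc => by rw [(Finset.mem_filter.1 hc).2], Finset.prod_pow_eq_pow_sum]

theorem Matrix.trace_pow_conj_diagonal {K n : Type*} [Field K] [Fintype n] [DecidableEq n]
    (Q : (Matrix n n K)ˣ) (D : n → K) (k : ℕ) :
    (((Q : Matrix n n K) * Matrix.diagonal D * ((Q⁻¹ : (Matrix n n K)ˣ) : Matrix n n K)) ^ k).trace
      = ∑ c, D c ^ k := by
  rw [Units.conj_pow, Matrix.trace_mul_comm, ← Matrix.mul_assoc, Units.inv_mul, Matrix.one_mul,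
    Matrix.diagonal_pow, Matrix.trace_diagonal]
  simp

/-- A stochastic matrix with eigenvalue `1` of multiplicity one, written in diagonalized form, has
a unique stationary distribution. -/
theorem Matrix.existsUnique_stationary_of_conj_diagonal {n : Type*} [Fintype n] [DecidableEq n]
    (Q : (Matrix n n ℝ)ˣ) (D : n → ℝ) (M : Matrix n n ℝ)
    (hM : M = (Q : Matrix n n ℝ) * Matrix.diagonal D *
      ((Q⁻¹ : (Matrix n n ℝ)ˣ) : Matrix n n ℝ))
    (hnonneg : ∀ i j, 0 ≤ M i j) (hrow : ∀ i, ∑ j, M i j = 1)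
    (c : n) (hc : D c = 1) (huniq : ∀ b, D b = 1 → b = c) :
    ∃! p : n → ℝ, p ∈ stdSimplex ℝ n ∧ Matrix.vecMul p M = p := by
  -- In the coordinates v Q, invariance forces every coordinate with D b ≠ 1 to vanish, so the fixed
  -- row vectors form at most a line.
  have key : ∀ v : n → ℝ, Matrix.vecMul v M = v →
      Matrix.vecMul v (Q : Matrix n n ℝ) = fun b =>
        if b = c then Matrix.vecMul v (Q : Matrix n n ℝ) c else 0 := by
    intro v hv
    have h1 : Matrix.vecMul (Matrix.vecMul v (Q : Matrix n n ℝ)) (Matrix.diagonal D) =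
        Matrix.vecMul v (Q : Matrix n n ℝ) := by
      conv_rhs => rw [← hv]
      rw [hM, Matrix.vecMul_vecMul, Matrix.vecMul_vecMul, Matrix.mul_assoc, Units.inv_mul,
        Matrix.mul_one]
    funext b
    split_ifs with hb
    · rw [hb]
    · have h2 := congrFun h1 b
      rw [Matrix.vecMul_diagonal] at h2
      by_contra h3
      exact hb (huniq b (mul_left_cancel₀ h3 (by rw [h2, mul_one])))
  have back : ∀ v : n → ℝ, v = Matrix.vecMul (Matrix.vecMul v (Q : Matrix n n ℝ))
      ((Q⁻¹ : (Matrix n n ℝ)ˣ) : Matrix n n ℝ) := fun v => by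
    rw [Matrix.vecMul_vecMul, Units.mul_inv, Matrix.vecMul_one]
  have hsum : ∀ v : n → ℝ, ∑ j, Matrix.vecMul v M j = ∑ i, v i := by
    intro v
    simp only [Matrix.vecMul, dotProduct]
    rw [Finset.sum_comm]
    exact Finset.sum_congr rfl fun i _ => by rw [← Finset.mul_sum, hrow, mul_one]
  let v : n → ℝ := Matrix.vecMul (Pi.single c 1) ((Q⁻¹ : (Matrix n n ℝ)ˣ) : Matrix n n ℝ)
  have hvQ : Matrix.vecMul v (Q : Matrix n n ℝ) = Pi.single c 1 := by
    simp only [v]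
    rw [Matrix.vecMul_vecMul, Units.inv_mul, Matrix.vecMul_one]
  have hv : Matrix.vecMul v M = v := by
    rw [hM, ← Matrix.vecMul_vecMul, ← Matrix.vecMul_vecMul, hvQ]
    simp only [v]
    congr 1
    funext b
    rw [Matrix.vecMul_diagonal]
    by_cases hb : b = c
    · subst hb; simp [hc]
    · simp [Pi.single_eq_of_ne hb]
  have hv0 : v ≠ 0 := by
    intro h
    have := congrFun hvQ c
    rw [h, Matrix.zero_vecMul] at this
    simp at this
  have habs_le : ∀ j, |v j| ≤ Matrix.vecMul (fun i => |v i|) M j := by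
    intro j
    conv_lhs => rw [← hv]
    simp only [Matrix.vecMul, dotProduct]
    refine (Finset.abs_sum_le_sum_abs _ _).trans (Finset.sum_le_sum fun i _ => ?_)
    rw [abs_mul, abs_of_nonneg (hnonneg i j)]
  -- The vectors |v| ≤ |v| M have the same total since rows sum to 1, so they agree; hence |v|
  -- normalized is a stationary distribution.
  have habs : Matrix.vecMul (fun i => |v i|) M = fun i => |v i| := by
    have := (Finset.sum_eq_sum_iff_of_le (s := Finset.univ) fun j _ => habs_le j).1
      (hsum fun i => |v i|).symm
    funext j
    exact (this j (Finset.mem_univ j)).symm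
  set S := ∑ i, |v i| with hS
  have hSpos : 0 < S := by
    obtain ⟨i, hi⟩ := Function.ne_iff.1 hv0
    exact Finset.sum_pos' (fun i _ => abs_nonneg _) ⟨i, Finset.mem_univ i, abs_pos.2 hi⟩
  refine ⟨S⁻¹ • fun i => |v i|, ⟨⟨fun i => ?_, ?_⟩, ?_⟩, ?_⟩
  · exact mul_nonneg (inv_nonneg.2 hSpos.le) (abs_nonneg _)
  · simp only [Pi.smul_apply, smul_eq_mul]
    rw [← Finset.mul_sum, ← hS, inv_mul_cancel₀ hSpos.ne']
  · rw [Matrix.smul_vecMul, habs]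
  · have hpq : ∀ p q : n → ℝ, (p ∈ stdSimplex ℝ n ∧ Matrix.vecMul p M = p) →
        (q ∈ stdSimplex ℝ n ∧ Matrix.vecMul q M = q) → p = q := by
      rintro p q ⟨hp, hpM⟩ ⟨hq, hqM⟩
      set a := Matrix.vecMul p (Q : Matrix n n ℝ) c with ha
      set b := Matrix.vecMul q (Q : Matrix n n ℝ) c with hb
      -- Cross-multiplying avoids having to know that a and b are nonzero; comparing total masses
      -- then gives a = b.
      have h1 : b • p = a • q := by
        rw [back (b • p), back (a • q)]
        congr 1
        rw [Matrix.smul_vecMul, Matrix.smul_vecMul, key p hpM, key q hqM]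
        funext x
        simp only [Pi.smul_apply, smul_eq_mul, ← ha, ← hb]
        split_ifs <;> ring
      have h2 : a = b := by
        have := congrArg (fun f : n → ℝ => ∑ i, f i) h1
        simp only [Pi.smul_apply, smul_eq_mul, ← Finset.mul_sum, hp.2, hq.2, mul_one] at this
        exact this.symm
      rw [back p, back q, key p hpM, key q hqM, ← ha, ← hb, h2]
    intro p hp
    refine hpq p _ hp ⟨⟨fun i => ?_, ?_⟩, ?_⟩
    · exact mul_nonneg (inv_nonneg.2 hSpos.le) (abs_nonneg _)
    · simp only [Pi.smul_apply, smul_eq_mul]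
      rw [← Finset.mul_sum, ← hS, inv_mul_cancel₀ hSpos.ne']
    · rw [Matrix.smul_vecMul, habs]

/-! ### Chambers of real arrangements by deletion and restriction -/

namespace RealArrangement

open Module

variable {V ι : Type*} [AddCommGroup V] [Module ℝ V]

/-- The positive coefficients are those making `f a` vanish: a segment crossing the wall of a inside
a chamber meets the wall in that chamber. -/
theorem exists_convexCombination_mem_chamber {f : ι → Dual ℝ V} {B P : Finset ι} {x y : V}
    {a : ι} (hx : ∀ k ∈ B, (k ∈ P → 0 < f k x) ∧ (k ∉ P → f k x < 0))
    (hy : ∀ k ∈ B, (k ∈ P → 0 < f k y) ∧ (k ∉ P → f k y < 0))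
    (hxa : 0 < f a x) (hya : f a y < 0) :
    ∀ k ∈ B, (k ∈ P → 0 < f k ((-f a y) • x + f a x • y)) ∧
      (k ∉ P → f k ((-f a y) • x + f a x • y) < 0) := by
  intro k hk
  simp only [map_add, map_smul, smul_eq_mul]
  refine ⟨fun hP => ?_, fun hP => ?_⟩
  · have h1 := mul_pos (neg_pos.2 hya) ((hx k hk).1 hP)
    have h2 := mul_pos hxa ((hy k hk).1 hP)
    linarith
  · have h1 := mul_neg_of_pos_of_neg (neg_pos.2 hya) ((hx k hk).2 hP)
    have h2 := mul_neg_of_pos_of_neg hxa ((hy k hk).2 hP)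
    linarith

/-- Some point of `U` lies strictly on the positive side of the forms in `P` and strictly on the
negative side of the other forms of `B`. -/
def IsChamber (f : ι → Dual ℝ V) (B : Finset ι) (U : Submodule ℝ V) (P : Finset ι) : Prop :=
  ∃ x ∈ U, ∀ k ∈ B, (k ∈ P → 0 < f k x) ∧ (k ∉ P → f k x < 0)

open Classical in
/-- The number of chambers which the forms in `B` cut out of `U`. -/
noncomputable def chamberCount (f : ι → Dual ℝ V) (B : Finset ι) (U : Submodule ℝ V) : ℤ :=
  ∑ P ∈ B.powerset, if IsChamber f B U P then 1 else 0

/-- The Whitney sum of the forms in `B`, restricted to `U`, where intersections are weighted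
by `g`. -/
noncomputable def whitneySum (f : ι → Dual ℝ V) (B : Finset ι) (U : Submodule ℝ V)
    (g : Submodule ℝ V → ℤ) : ℤ :=
  ∑ S ∈ B.powerset, (-1) ^ (S.card + finrank ℝ U +
    finrank ℝ (U ⊓ S.inf fun k => LinearMap.ker (f k) : Submodule ℝ V)) *
      g (U ⊓ S.inf fun k => LinearMap.ker (f k))

theorem whitneySum_empty (f : ι → Dual ℝ V) (U : Submodule ℝ V) (g : Submodule ℝ V → ℤ) :
    whitneySum f ∅ U g = g U := by
  have h : (U ⊓ (∅ : Finset ι).inf fun k => LinearMap.ker (f k)) = U := by simp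
  rw [whitneySum, Finset.powerset_empty, Finset.sum_singleton, h, Finset.card_empty, zero_add,
    ← two_mul, pow_mul, neg_one_sq, one_pow, one_mul]

variable [DecidableEq ι]

/-- Adding a to S flips the sign without changing the intersection, so terms cancel in pairs. -/
theorem whitneySum_insert_of_le (f : ι → Dual ℝ V) {B : Finset ι} {a : ι} (ha : a ∉ B)
    {U : Submodule ℝ V} (hU : U ≤ LinearMap.ker (f a)) (g : Submodule ℝ V → ℤ) :
    whitneySum f (insert a B) U g = 0 := by
  rw [whitneySum, Finset.sum_powerset_insert ha, ← Finset.sum_add_distrib]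
  refine Finset.sum_eq_zero fun S hS => ?_
  have haS : a ∉ S := fun h => ha (Finset.mem_powerset.1 hS h)
  rw [Finset.inf_insert, ← inf_assoc, inf_eq_left.2 hU, Finset.card_insert_of_notMem haS]
  ring

theorem finrank_inf_ker_add_one [FiniteDimensional ℝ V] {φ : Dual ℝ V} {U : Submodule ℝ V}
    (hU : ¬ U ≤ LinearMap.ker φ) :
    finrank ℝ (U ⊓ LinearMap.ker φ : Submodule ℝ V) + 1 = finrank ℝ U := by
  have h0 : φ.comp U.subtype ≠ 0 := by
    intro h
    exact hU fun x hx => by simpa using LinearMap.congr_fun h ⟨x, hx⟩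
  have h1 := Module.Dual.finrank_ker_add_one_of_ne_zero (f := φ.comp U.subtype) h0
  rw [← h1]
  congr 1
  have h2 : U ⊓ LinearMap.ker φ = (LinearMap.ker (φ.comp U.subtype)).map U.subtype := by
    rw [LinearMap.ker_comp, Submodule.map_comap_subtype]
  rw [h2]
  exact (LinearEquiv.finrank_eq
    (Submodule.equivMapOfInjective U.subtype U.subtype_injective _)).symm

/-- For S containing a, the extra element of S and the drop of dim U by one contribute two signs
that cancel, hence the plus. -/
theorem whitneySum_insert_of_not_le [FiniteDimensional ℝ V] (f : ι → Dual ℝ V) {B : Finset ι}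
    {a : ι} (ha : a ∉ B) {U : Submodule ℝ V} (hU : ¬ U ≤ LinearMap.ker (f a))
    (g : Submodule ℝ V → ℤ) :
    whitneySum f (insert a B) U g =
      whitneySum f B U g + whitneySum f B (U ⊓ LinearMap.ker (f a)) g := by
  rw [whitneySum, Finset.sum_powerset_insert ha]
  congr 1
  refine Finset.sum_congr rfl fun S hS => ?_
  have haS : a ∉ S := fun h => ha (Finset.mem_powerset.1 hS h)
  rw [Finset.inf_insert, ← inf_assoc, Finset.card_insert_of_notMem haS,
    ← finrank_inf_ker_add_one hU]
  ring

/-- Taking g to be the indicator of one subspace will give the sign of the Möbius function. -/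
theorem whitneySum_nonneg [FiniteDimensional ℝ V] (f : ι → Dual ℝ V) (B : Finset ι)
    (U : Submodule ℝ V) {g : Submodule ℝ V → ℤ} (hg : ∀ X, 0 ≤ g X) :
    0 ≤ whitneySum f B U g := by
  induction B using Finset.induction_on generalizing U with
  | empty =>
    exact (hg U).trans_eq (whitneySum_empty f U g).symm
  | insert a B ha ih =>
    by_cases hU : U ≤ LinearMap.ker (f a)
    · exact (whitneySum_insert_of_le f ha hU g).ge
    · rw [whitneySum_insert_of_not_le f ha hU]
      exact add_nonneg (ih _) (ih _)

theorem chamberCount_insert_of_le (f : ι → Dual ℝ V) {B : Finset ι} {a : ι}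
    {U : Submodule ℝ V} (hU : U ≤ LinearMap.ker (f a)) :
    chamberCount f (insert a B) U = 0 := by
  refine Finset.sum_eq_zero fun P _ => if_neg ?_
  rintro ⟨x, hx, h⟩
  have h0 : f a x = 0 := hU hx
  obtain ⟨h1, h2⟩ := h a (Finset.mem_insert_self a B)
  by_cases haP : a ∈ P
  · exact (h1 haP).ne' h0
  · exact (h2 haP).ne h0

theorem isChamber_insert_self {f : ι → Dual ℝ V} {B P : Finset ι} {a : ι} {U : Submodule ℝ V}
    (haB : a ∉ B) :
    IsChamber f (insert a B) U (insert a P) ↔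
      ∃ x ∈ U, (∀ k ∈ B, (k ∈ P → 0 < f k x) ∧ (k ∉ P → f k x < 0)) ∧ 0 < f a x := by
  refine exists_congr fun x => and_congr_right fun _ => ?_
  rw [Finset.forall_mem_insert, and_comm]
  refine and_congr (forall₂_congr fun k hk => ?_) (by simp)
  have : k ≠ a := fun h => haB (h ▸ hk)
  simp [this]

theorem isChamber_insert_of_notMem {f : ι → Dual ℝ V} {B P : Finset ι} {a : ι}
    {U : Submodule ℝ V} (haP : a ∉ P) :
    IsChamber f (insert a B) U P ↔
      ∃ x ∈ U, (∀ k ∈ B, (k ∈ P → 0 < f k x) ∧ (k ∉ P → f k x < 0)) ∧ f a x < 0 := by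
  refine exists_congr fun x => and_congr_right fun _ => ?_
  rw [Finset.forall_mem_insert, and_comm]
  simp [haP]

theorem exists_add_smul_mem_chamber {f : ι → Dual ℝ V} {B P : Finset ι} {x : V}
    (hx : ∀ k ∈ B, (k ∈ P → 0 < f k x) ∧ (k ∉ P → f k x < 0)) (y : V) :
    ∃ ε : ℝ, 0 < ε ∧
      ∀ k ∈ B, (k ∈ P → 0 < f k (x + ε • y)) ∧ (k ∉ P → f k (x + ε • y) < 0) := by
  have hlim : ∀ k, Filter.Tendsto (fun ε : ℝ => f k (x + ε • y)) (nhdsWithin 0 (Set.Ioi 0))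
      (nhds (f k x)) := by
    intro k
    have : Continuous fun ε : ℝ => f k x + ε * f k y := by fun_prop
    have h := (this.tendsto 0).mono_left (nhdsWithin_le_nhds (s := Set.Ioi 0))
    simpa using h
  have hev : ∀ᶠ ε : ℝ in nhdsWithin 0 (Set.Ioi 0),
      ∀ k ∈ B, (k ∈ P → 0 < f k (x + ε • y)) ∧ (k ∉ P → f k (x + ε • y) < 0) := by
    rw [Filter.eventually_all_finset]
    intro k hk
    by_cases hP : k ∈ P
    · filter_upwards [(hlim k).eventually (lt_mem_nhds ((hx k hk).1 hP))] with ε hε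
      exact ⟨fun _ => hε, fun h => absurd hP h⟩
    · filter_upwards [(hlim k).eventually (gt_mem_nhds ((hx k hk).2 hP))] with ε hε
      exact ⟨fun h => absurd h hP, fun _ => hε⟩
  obtain ⟨ε, h1, h2⟩ := (hev.and self_mem_nhdsWithin).exists
  exact ⟨ε, h2, h1⟩

/-- For a fixed sign pattern on B let p and q say that its cell has points on the negative,
respectively positive, side of a. The cell is nonempty iff p ∨ q and meets the wall iff p ∧ q, and
[p] + [q] = [p ∨ q] + [p ∧ q]. -/
theorem chamberCount_insert_of_not_le (f : ι → Dual ℝ V) {B : Finset ι} {a : ι} (ha : a ∉ B)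
    {U : Submodule ℝ V} (hU : ¬ U ≤ LinearMap.ker (f a)) :
    chamberCount f (insert a B) U =
      chamberCount f B U + chamberCount f B (U ⊓ LinearMap.ker (f a)) := by
  classical
  simp only [chamberCount]
  rw [Finset.sum_powerset_insert ha, ← Finset.sum_add_distrib, ← Finset.sum_add_distrib]
  refine Finset.sum_congr rfl fun P hP => ?_
  have haP : a ∉ P := fun h => ha (Finset.mem_powerset.1 hP h)
  set p := IsChamber f (insert a B) U P with hp
  set q := IsChamber f (insert a B) U (insert a P) with hq
  rw [isChamber_insert_of_notMem haP] at hp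
  rw [isChamber_insert_self ha] at hq
  obtain ⟨y, hyU, hy⟩ : ∃ y ∈ U, 0 < f a y := by
    obtain ⟨y, hyU, hy⟩ := SetLike.not_le_iff_exists.1 hU
    rcases lt_or_gt_of_ne (show f a y ≠ 0 from hy) with h | h
    · exact ⟨-y, U.neg_mem hyU, by simpa using h⟩
    · exact ⟨y, hyU, h⟩
  have hboth : IsChamber f B (U ⊓ LinearMap.ker (f a)) P ↔ p ∧ q := by
    rw [hp, hq]
    constructor
    · rintro ⟨x, ⟨hxU, hxa⟩, hx⟩
      have hxa : f a x = 0 := hxa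
      obtain ⟨ε, hε, h⟩ := exists_add_smul_mem_chamber hx y
      obtain ⟨δ, hδ, h'⟩ := exists_add_smul_mem_chamber hx (-y)
      refine ⟨⟨x + δ • -y, U.add_mem hxU (U.smul_mem _ (U.neg_mem hyU)), h', ?_⟩,
        ⟨x + ε • y, U.add_mem hxU (U.smul_mem _ hyU), h, ?_⟩⟩
      · simpa [hxa] using mul_pos hδ hy
      · simpa [hxa] using mul_pos hε hy
    · rintro ⟨⟨z, hzU, hz, hza⟩, ⟨x, hxU, hx, hxa⟩⟩
      refine ⟨(-f a z) • x + f a x • z, ⟨U.add_mem (U.smul_mem _ hxU) (U.smul_mem _ hzU), ?_⟩,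
        exists_convexCombination_mem_chamber hx hz hxa hza⟩
      simp only [SetLike.mem_coe, LinearMap.mem_ker, map_add, map_smul, smul_eq_mul]
      ring
  have heither : IsChamber f B U P ↔ p ∨ q := by
    rw [hp, hq]
    constructor
    · rintro ⟨x, hxU, hx⟩
      rcases lt_trichotomy (f a x) 0 with h | h | h
      · exact Or.inl ⟨x, hxU, hx, h⟩
      · obtain ⟨ε, hε, h'⟩ := exists_add_smul_mem_chamber hx y
        refine Or.inr ⟨x + ε • y, U.add_mem hxU (U.smul_mem _ hyU), h', ?_⟩
        simpa [h] using mul_pos hε hy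
      · exact Or.inr ⟨x, hxU, hx, h⟩
    · rintro (⟨x, hxU, hx, -⟩ | ⟨x, hxU, hx, -⟩) <;> exact ⟨x, hxU, hx⟩
  simp only [hboth, heither]
  by_cases h1 : p <;> by_cases h2 : q <;> simp [h1, h2]

/-- **Zaslavsky's theorem** in Whitney's form: the number of chambers of an arrangement. -/
theorem chamberCount_eq_whitneySum [FiniteDimensional ℝ V] (f : ι → Dual ℝ V) (B : Finset ι)
    (U : Submodule ℝ V) : chamberCount f B U = whitneySum f B U fun _ => 1 := by
  induction B using Finset.induction_on generalizing U with
  | empty =>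
    rw [whitneySum_empty, chamberCount, Finset.powerset_empty, Finset.sum_singleton,
      if_pos ⟨0, U.zero_mem, by simp⟩]
  | insert a B ha ih =>
    by_cases hU : U ≤ LinearMap.ker (f a)
    · rw [whitneySum_insert_of_le f ha hU, chamberCount_insert_of_le f hU]
    · rw [whitneySum_insert_of_not_le f ha hU, chamberCount_insert_of_not_le f ha hU, ih, ih]

end RealArrangement


/-! ### Complex signs and their composition -/

namespace CSign

theorem lt_iff_level_lt {x y : CSign} : x < y ↔ x.level < y.level := by
  rw [lt_iff_le_and_ne]
  constructor
  · rintro ⟨rfl | h, hne⟩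
    · exact absurd rfl hne
    · exact h
  · intro h
    exact ⟨Or.inr h, fun hxy => by simp [hxy] at h⟩

theorem level_le_two (x : CSign) : x.level ≤ 2 := by
  cases x <;> simp [level]

theorem level_ofComplex_eq_zero_iff {c : ℂ} : (ofComplex c).level = 0 ↔ c = 0 := by
  unfold ofComplex
  rw [Complex.ext_iff, Complex.zero_re, Complex.zero_im]
  split_ifs with h1 h2 h3 h4 <;> simp only [level]
  · simp [h1.ne']
  · simp [h2.ne]
  · simp [h3.ne']
  · simp [h4.ne]
  · exact iff_of_true trivial ⟨le_antisymm (not_lt.1 h3) (not_lt.1 h4),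
      le_antisymm (not_lt.1 h1) (not_lt.1 h2)⟩

theorem level_ofComplex_le_one_iff {c : ℂ} : (ofComplex c).level ≤ 1 ↔ c.im = 0 := by
  unfold ofComplex
  split_ifs with h1 h2 h3 h4 <;> simp only [level]
  · simp [h1.ne']
  · simp [h2.ne]
  all_goals simpa using le_antisymm (not_lt.1 h1) (not_lt.1 h2)

theorem ofComplex_eq_i_iff {c : ℂ} : ofComplex c = i ↔ 0 < c.im := by
  unfold ofComplex
  split_ifs with h1 h2 h3 h4 <;> simp [h1]

theorem eq_of_level_eq_two {x y : CSign} (hx : x.level = 2) (hy : y.level = 2)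
    (h : x = i ↔ y = i) : x = y := by
  cases x <;> cases y <;> simp_all [level]

variable {t : ℕ}

theorem comp_of_level_lt {Z W : Fin t → CSign} {k : Fin t} (h : (Z k).level < (W k).level) :
    comp Z W k = W k :=
  if_pos (lt_iff_level_lt.2 h)

theorem comp_of_level_le {Z W : Fin t → CSign} {k : Fin t} (h : (W k).level ≤ (Z k).level) :
    comp Z W k = Z k :=
  if_neg fun h' => (lt_iff_level_lt.1 h').not_ge h

theorem level_comp (Z W : Fin t → CSign) (k : Fin t) :
    (comp Z W k).level = max (Z k).level (W k).level := by
  rcases lt_or_ge (Z k).level (W k).level with h | h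
  · rw [comp_of_level_lt h, max_eq_right h.le]
  · rw [comp_of_level_le h, max_eq_left h]

theorem comp_eq_left {Z W : Fin t → CSign} (h : ∀ k, (W k).level ≤ (Z k).level) :
    comp Z W = Z :=
  funext fun k => comp_of_level_le (h k)

/-- Both sides select, in each coordinate, the leftmost entry of maximal level. -/
theorem comp_assoc (X Y Z : Fin t → CSign) : comp (comp X Y) Z = comp X (comp Y Z) := by
  funext k
  have h1 := level_comp X Y k
  have h2 := level_comp Y Z k
  rcases lt_or_ge (Y k).level (Z k).level with hYZ | hYZ
  · rw [max_eq_right hYZ.le] at h2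
    rcases lt_or_ge (X k).level (Z k).level with hXZ | hXZ
    · rw [comp_of_level_lt (by rw [h1]; exact max_lt hXZ hYZ), comp_of_level_lt (by rwa [h2]),
        comp_of_level_lt hYZ]
    · rw [comp_of_level_le (Z := X) (by rwa [h2]), comp_of_level_le (by rw [h1]; simp [hXZ]),
        comp_of_level_le (hYZ.le.trans hXZ)]
  · rw [max_eq_left hYZ] at h2
    rw [comp_of_level_le (by rw [h1]; simp [hYZ])]
    rcases lt_or_ge (X k).level (Y k).level with hXY | hXY
    · rw [comp_of_level_lt hXY, comp_of_level_lt (by rwa [h2]), comp_of_level_le hYZ]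
    · rw [comp_of_level_le hXY, comp_of_level_le (by rwa [h2])]

theorem ofComplex_congr {x y : ℂ} (h1 : 0 < x.im ↔ 0 < y.im) (h2 : x.im < 0 ↔ y.im < 0)
    (h3 : x.im = 0 → (0 < x.re ↔ 0 < y.re) ∧ (x.re < 0 ↔ y.re < 0)) :
    ofComplex x = ofComplex y := by
  unfold ofComplex
  by_cases hx1 : 0 < x.im
  · rw [if_pos hx1, if_pos (h1.1 hx1)]
  by_cases hx2 : x.im < 0
  · rw [if_neg hx1, if_neg (mt h1.2 hx1), if_pos hx2, if_pos (h2.1 hx2)]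
  obtain ⟨h4, h5⟩ := h3 (le_antisymm (not_lt.1 hx1) (not_lt.1 hx2))
  simp only [h1, h2, h4, h5]

theorem eventually_sign_add_mul {a : ℝ} (ha : a ≠ 0) (b : ℝ) :
    ∀ᶠ ε : ℝ in nhdsWithin 0 (Set.Ioi 0), (0 < a + ε * b ↔ 0 < a) ∧ (a + ε * b < 0 ↔ a < 0) := by
  have hlim : Filter.Tendsto (fun ε : ℝ => a + ε * b) (nhdsWithin 0 (Set.Ioi 0)) (nhds a) := by
    have : Continuous fun ε : ℝ => a + ε * b := by fun_prop
    simpa using (this.tendsto 0).mono_left (nhdsWithin_le_nhds (s := Set.Ioi 0))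
  rcases lt_or_gt_of_ne ha with h | h
  · filter_upwards [hlim.eventually (gt_mem_nhds h)] with ε hε
    exact ⟨iff_of_false hε.not_gt h.not_gt, iff_of_true hε h⟩
  · filter_upwards [hlim.eventually (lt_mem_nhds h)] with ε hε
    exact ⟨iff_of_true hε h, iff_of_false hε.not_gt h.not_gt⟩

theorem ofComplex_smul {ε : ℝ} (hε : 0 < ε) (b : ℂ) : ofComplex (ε • b) = ofComplex b :=
  ofComplex_congr (by simp [hε]) (by simp [mul_neg_iff, hε, hε.not_gt])
    fun _ => ⟨by simp [hε], by simp [mul_neg_iff, hε, hε.not_gt]⟩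

/-- Either a = 0, or a is real and b is not; in the latter case the imaginary part of the sum is
that of ε b. -/
theorem eventually_ofComplex_add_smul_of_level_lt {a b : ℂ}
    (h : (ofComplex a).level < (ofComplex b).level) :
    ∀ᶠ ε : ℝ in nhdsWithin 0 (Set.Ioi 0), ofComplex (a + ε • b) = ofComplex b := by
  filter_upwards [self_mem_nhdsWithin] with ε hε
  rw [← ofComplex_smul hε b]
  by_cases ha0 : a = 0
  · rw [ha0, zero_add]
  have ha1 : a.im = 0 :=
    level_ofComplex_le_one_iff.1 (Nat.le_of_lt_succ (h.trans_le (level_le_two _)))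
  have hb : b.im ≠ 0 := fun hb => ha0 <| level_ofComplex_eq_zero_iff.1 <|
    Nat.lt_one_iff.1 (h.trans_le (level_ofComplex_le_one_iff.2 hb))
  exact ofComplex_congr (by simp [ha1]) (by simp [ha1])
    fun h0 => absurd h0 (by simpa [ha1] using ⟨hε.ne', hb⟩)

theorem eventually_ofComplex_add_smul_of_level_le {a b : ℂ}
    (h : (ofComplex b).level ≤ (ofComplex a).level) :
    ∀ᶠ ε : ℝ in nhdsWithin 0 (Set.Ioi 0), ofComplex (a + ε • b) = ofComplex a := by
  by_cases ha : a.im = 0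
  · have hb : b.im = 0 :=
      level_ofComplex_le_one_iff.1 (h.trans (level_ofComplex_le_one_iff.2 ha))
    by_cases ha' : a.re = 0
    · have ha0 : a = 0 := Complex.ext ha' ha
      have hb0 : b = 0 := level_ofComplex_eq_zero_iff.1 <| Nat.le_zero.1 <|
        h.trans_eq (level_ofComplex_eq_zero_iff.2 ha0)
      simp [hb0]
    · filter_upwards [eventually_sign_add_mul ha' b.re] with ε hε
      exact ofComplex_congr (by simp [hb]) (by simp [hb]) fun _ => by simpa using hε
  · filter_upwards [eventually_sign_add_mul ha b.im] with ε hε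
    exact ofComplex_congr (by simpa using hε.1) (by simpa using hε.2) fun h0 => by
      have h0 : a.im + ε * b.im = 0 := by simpa using h0
      rw [h0] at hε
      simp only [lt_irrefl, false_iff, not_lt] at hε
      exact absurd (le_antisymm hε.1 hε.2) ha

end CSign

/-! ### The monoid of faces and the span map -/

namespace CArrangement

open Module

variable {d t : ℕ} (A : CArrangement d t)

/-- The imaginary part of the `k`-th linear form. -/
noncomputable def imForm (k : Fin t) : Dual ℝ (Fin d → ℂ) :=
  Complex.imLm ∘ₗ (A.form k).restrictScalars ℝ

theorem imForm_apply (k : Fin t) (z : Fin d → ℂ) : A.imForm k z = (A.form k z).im := rfl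

theorem ker_imForm (k : Fin t) : LinearMap.ker (A.imForm k) = A.realHyperplane k := rfl

/-- The real part of ℓ(z) is the imaginary part of ℓ(iz), so the imaginary part determines the form.
-/
theorem imForm_ne_zero (k : Fin t) : A.imForm k ≠ 0 := by
  intro h
  refine A.form_ne_zero k (LinearMap.ext fun z => Complex.ext ?_ ?_)
  · have := LinearMap.congr_fun h (Complex.I • z)
    simpa [imForm_apply] using this
  · exact LinearMap.congr_fun h z

theorem mem_hyperplane_iff {k : Fin t} {z : Fin d → ℂ} :
    z ∈ A.hyperplane k ↔ (A.sign z k).level = 0 :=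
  CSign.level_ofComplex_eq_zero_iff.symm

theorem mem_realHyperplane_iff {k : Fin t} {z : Fin d → ℂ} :
    z ∈ A.realHyperplane k ↔ (A.sign z k).level ≤ 1 :=
  CSign.level_ofComplex_le_one_iff.symm

theorem hyperplane_le_realHyperplane (k : Fin t) : A.hyperplane k ≤ A.realHyperplane k :=
  fun _ hz => A.mem_realHyperplane_iff.2 ((A.mem_hyperplane_iff.1 hz).le.trans zero_le_one)

theorem realHyperplane_ne_top (k : Fin t) : A.realHyperplane k ≠ ⊤ := by
  rw [← ker_imForm, Ne, LinearMap.ker_eq_top]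
  exact A.imForm_ne_zero k

/-- Every point is moved a little to obtain the composition of two sign vectors. -/
theorem exists_sign_eq_comp (z z' : Fin d → ℂ) :
    ∃ y, A.sign y = CSign.comp (A.sign z) (A.sign z') := by
  have h : ∀ k, ∀ᶠ ε : ℝ in nhdsWithin 0 (Set.Ioi 0),
      A.sign (z + ε • z') k = CSign.comp (A.sign z) (A.sign z') k := by
    intro k
    have hk : ∀ ε : ℝ, A.sign (z + ε • z') k =
        CSign.ofComplex (A.form k z + ε • A.form k z') := fun ε => by
      rw [sign, map_add, LinearMap.map_smul_of_tower]
    simp only [hk]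
    rcases lt_or_ge (A.sign z k).level (A.sign z' k).level with h | h
    · rw [CSign.comp_of_level_lt h]
      exact CSign.eventually_ofComplex_add_smul_of_level_lt h
    · rw [CSign.comp_of_level_le h]
      exact CSign.eventually_ofComplex_add_smul_of_level_le h
  obtain ⟨ε, hε⟩ := (Filter.eventually_all.2 h).exists
  exact ⟨z + ε • z', funext hε⟩

/-- The composition of two faces. -/
noncomputable def faceComp (F G : A.Face) : A.Face :=
  ⟨CSign.comp F.1 G.1, by
    obtain ⟨_, z, rfl⟩ := F
    obtain ⟨_, z', rfl⟩ := G
    exact A.exists_sign_eq_comp z z'⟩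

/-- The face of the origin. -/
noncomputable def zeroFace : A.Face := ⟨A.sign 0, 0, rfl⟩

variable {A}

theorem level_faceComp (F G : A.Face) (k : Fin t) :
    ((A.faceComp F G).1 k).level = max (F.1 k).level (G.1 k).level :=
  CSign.level_comp _ _ _

theorem faceComp_assoc (F G H : A.Face) :
    A.faceComp (A.faceComp F G) H = A.faceComp F (A.faceComp G H) :=
  Subtype.ext (CSign.comp_assoc _ _ _)

theorem level_zeroFace (k : Fin t) : (A.zeroFace.1 k).level = 0 :=
  A.mem_hyperplane_iff.1 (Submodule.zero_mem _)

theorem zeroFace_comp (F : A.Face) : A.faceComp A.zeroFace F = F := by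
  refine Subtype.ext (funext fun k => ?_)
  rcases Nat.eq_zero_or_pos (F.1 k).level with h | h
  · have h' := level_zeroFace (A := A) k
    refine (CSign.comp_of_level_le (by rw [h]; exact Nat.zero_le _)).trans ?_
    have : ∀ x y : CSign, x.level = 0 → y.level = 0 → x = y := by
      intro x y hx hy
      cases x <;> cases y <;> simp_all [CSign.level]
    exact this _ _ h' h
  · exact CSign.comp_of_level_lt (by rw [level_zeroFace]; exact h)

/-- A real vector space is not a finite union of kernels of nonzero functionals. -/
theorem exists_forall_level_eq_two : ∃ F : A.Face, ∀ k, (F.1 k).level = 2 := by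
  obtain ⟨z, hz⟩ := Module.Dual.exists_forall_ne_zero_of_forall_exists A.imForm fun k => by
    by_contra! h
    exact A.imForm_ne_zero k (LinearMap.ext h)
  refine ⟨⟨A.sign z, z, rfl⟩, fun k => le_antisymm (CSign.level_le_two _) (not_lt.1 fun h => ?_)⟩
  exact hz k (A.mem_realHyperplane_iff.2 (Nat.le_of_lt_succ h))

theorem isMax_iff (C : A.Face) : IsMax C ↔ ∀ k, (C.1 k).level = 2 := by
  constructor
  · intro hC k
    obtain ⟨F, hF⟩ := exists_forall_level_eq_two (A := A)
    have hle : C ≤ A.faceComp C F := by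
      intro k
      rcases lt_or_ge (C.1 k).level (F.1 k).level with h | h
      · refine Or.inr (h.trans_eq ?_)
        rw [level_faceComp, max_eq_right h.le]
      · exact Or.inl (CSign.comp_of_level_le h).symm
    rw [hC.eq_of_le hle, level_faceComp, hF]
    exact max_eq_right (CSign.level_le_two _)
  · intro h F hF k
    rcases hF k with h' | h'
    · exact Or.inl h'.symm
    · exact absurd (h'.trans_le (CSign.level_le_two _)) (by rw [h k]; exact lt_irrefl _)

/-- A face acts on the maximal faces by composition on the left. -/
noncomputable def act (F : A.Face) (C : A.MaxFace) : A.MaxFace :=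
  ⟨A.faceComp F C.1, (isMax_iff _).2 fun k => by
    rw [level_faceComp, (isMax_iff _).1 C.2 k]
    exact max_eq_right (CSign.level_le_two _)⟩

theorem act_act (F G : A.Face) (C : A.MaxFace) : act F (act G C) = act (A.faceComp F G) C :=
  Subtype.ext (faceComp_assoc _ _ _).symm

theorem zeroFace_act (C : A.MaxFace) : act A.zeroFace C = C :=
  Subtype.ext (zeroFace_comp _)

theorem cone_subset_iff (F : A.Face) {p : (Fin t → CSign) → Prop} {H : Submodule ℝ (Fin d → ℂ)}
    (h : ∀ z, z ∈ H ↔ p (A.sign z)) : A.cone F ⊆ H ↔ p F.1 := by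
  constructor
  · intro hF
    obtain ⟨z, hz⟩ := F.2
    exact hz ▸ (h z).1 (hF hz)
  · intro hF z hz
    exact (h z).2 ((show A.sign z = F.1 from hz) ▸ hF)

theorem cone_subset_hyperplane_iff (F : A.Face) (k : Fin t) :
    A.cone F ⊆ A.hyperplane k ↔ (F.1 k).level = 0 :=
  cone_subset_iff F (p := fun Z => (Z k).level = 0) fun _ => A.mem_hyperplane_iff

theorem cone_subset_realHyperplane_iff (F : A.Face) (k : Fin t) :
    A.cone F ⊆ A.realHyperplane k ↔ (F.1 k).level ≤ 1 :=
  cone_subset_iff F (p := fun Z => (Z k).level ≤ 1) fun _ => A.mem_realHyperplane_iff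

theorem span_le_of_mem_augmented {F : A.Face} {H : Submodule ℝ (Fin d → ℂ)}
    (hH : H ∈ A.augmented) : (A.span F).1 ≤ H ↔ A.cone F ⊆ H := by
  constructor
  · intro h
    refine Set.Subset.trans (fun z hz => ?_) (SetLike.coe_subset_coe.2 h)
    exact (Submodule.mem_sInf).2 fun K hK => hK.2 hz
  · intro h
    exact sInf_le ⟨hH, h⟩

theorem span_le_hyperplane_iff (F : A.Face) (k : Fin t) :
    (A.span F).1 ≤ A.hyperplane k ↔ (F.1 k).level = 0 := by
  rw [span_le_of_mem_augmented (Or.inl ⟨k, rfl⟩), cone_subset_hyperplane_iff]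

theorem span_le_realHyperplane_iff (F : A.Face) (k : Fin t) :
    (A.span F).1 ≤ A.realHyperplane k ↔ (F.1 k).level ≤ 1 := by
  rw [span_le_of_mem_augmented (Or.inr ⟨k, rfl⟩), cone_subset_realHyperplane_iff]

theorem span_le_iff {F : A.Face} {X : A.AugLattice} :
    A.span F ≤ X ↔ (∀ k, X.1 ≤ A.hyperplane k → (F.1 k).level = 0) ∧
      ∀ k, X.1 ≤ A.realHyperplane k → (F.1 k).level ≤ 1 := by
  constructor
  · intro h
    exact ⟨fun k hk => (span_le_hyperplane_iff F k).1 (le_trans h hk),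
      fun k hk => (span_le_realHyperplane_iff F k).1 (le_trans h hk)⟩
  · rintro ⟨h1, h2⟩
    obtain ⟨X, S, hS, rfl⟩ := X
    change sInf _ ≤ sInf S
    refine le_sInf fun H hH => ?_
    rcases hS hH with ⟨k, rfl⟩ | ⟨k, rfl⟩
    · exact (span_le_hyperplane_iff F k).2 (h1 k (sInf_le hH))
    · exact (span_le_realHyperplane_iff F k).2 (h2 k (sInf_le hH))

theorem span_faceComp_le_iff {F G : A.Face} {X : A.AugLattice} :
    A.span (A.faceComp F G) ≤ X ↔ A.span F ≤ X ∧ A.span G ≤ X := by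
  simp only [span_le_iff, level_faceComp, max_le_iff, Nat.max_eq_zero_iff]
  constructor
  · exact fun h => ⟨⟨fun k hk => (h.1 k hk).1, fun k hk => (h.2 k hk).1⟩,
      ⟨fun k hk => (h.1 k hk).2, fun k hk => (h.2 k hk).2⟩⟩
  · exact fun h => ⟨fun k hk => ⟨h.1.1 k hk, h.2.1 k hk⟩, fun k hk => ⟨h.1.2 k hk, h.2.2 k hk⟩⟩

/-- The hypothesis bounds each level of G by that of F, whether the latter is 0, 1 or 2 (no
constraint), and ties keep the left entry. -/
theorem faceComp_eq_left {F G : A.Face} (h : A.span G ≤ A.span F) : A.faceComp F G = F := by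
  obtain ⟨h1, h2⟩ := span_le_iff.1 h
  refine Subtype.ext (CSign.comp_eq_left fun k => ?_)
  have h3 := fun hk => h1 k ((span_le_hyperplane_iff F k).2 hk)
  have h4 := fun hk => h2 k ((span_le_realHyperplane_iff F k).2 hk)
  have h5 := CSign.level_le_two (G.1 k)
  omega

end CArrangement


/-! ### The Möbius function and chambers of localizations -/

namespace CArrangement

open Module

variable {d t : ℕ} {A : CArrangement d t}

variable (A) in
/-- The intersection of the real hyperplanes indexed by `S`. -/
noncomputable def realInf (S : Finset (Fin t)) : A.AugLattice :=
  ⟨S.inf A.realHyperplane, A.realHyperplane '' S, by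
    rintro _ ⟨k, -, rfl⟩
    exact Or.inr ⟨k, rfl⟩, Finset.inf_eq_sInf_image _ _⟩

theorem le_realInf_iff {X : A.AugLattice} {S : Finset (Fin t)} :
    X ≤ A.realInf S ↔ ∀ k ∈ S, X.1 ≤ A.realHyperplane k := by
  change X.1 ≤ S.inf A.realHyperplane ↔ _
  exact Finset.le_inf_iff

open Classical in
variable (A) in
/-- The signed count of the families of real hyperplanes whose intersection is `X`. -/
noncomputable def whitneyCoeff (X : A.AugLattice) : ℤ :=
  ∑ S : Finset (Fin t), if A.realInf S = X then (-1) ^ S.card else 0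

/-- Since H_k lies in H_k^ℝ, the real hyperplanes alone dominate all proper elements; this is why
only they enter `whitneyCoeff`. -/
theorem exists_le_realHyperplane {X : A.AugLattice} (hX : X ≠ ⊤) :
    ∃ k, X.1 ≤ A.realHyperplane k := by
  obtain ⟨X, S, hS, rfl⟩ := X
  rcases S.eq_empty_or_nonempty with rfl | ⟨H, hH⟩
  · exact absurd (Subtype.ext sInf_empty) hX
  · rcases hS hH with ⟨k, rfl⟩ | ⟨k, rfl⟩
    · exact ⟨k, (sInf_le hH).trans (A.hyperplane_le_realHyperplane k)⟩
    · exact ⟨k, sInf_le hH⟩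

open Classical in
-- The sum is the alternating count of all subsets of T, which vanishes unless T is empty.
theorem sum_Icc_whitneyCoeff (X : A.AugLattice) :
    ∑ Y ∈ Finset.Icc X ⊤, A.whitneyCoeff Y = if X = ⊤ then 1 else 0 := by
  set T : Finset (Fin t) := Finset.univ.filter fun k => X.1 ≤ A.realHyperplane k with hT
  have h1 : ∑ Y ∈ Finset.Icc X ⊤, A.whitneyCoeff Y = ∑ S ∈ T.powerset, (-1 : ℤ) ^ S.card := by
    simp only [whitneyCoeff]
    rw [Finset.sum_comm]
    simp only [Finset.sum_ite_eq, Finset.mem_Icc, le_top, and_true]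
    rw [← Finset.sum_filter]
    refine Finset.sum_congr (Finset.ext fun S => ?_) fun _ _ => rfl
    simp [le_realInf_iff, hT, Finset.subset_iff]
  rw [h1, Finset.sum_powerset_neg_one_pow_card]
  refine if_congr ?_ rfl rfl
  rw [hT, Finset.filter_eq_empty_iff]
  constructor
  · intro h
    by_contra hX
    obtain ⟨k, hk⟩ := exists_le_realHyperplane hX
    exact h (Finset.mem_univ k) hk
  · rintro rfl k - hk
    exact A.realHyperplane_ne_top k (top_le_iff.1 hk)

/-- Crosscut argument: both functions satisfy the recursion that determines μ(·, 1̂) downwards from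
the top. -/
theorem muTop_eq_whitneyCoeff (X : A.AugLattice) : A.muTop X = A.whitneyCoeff X := by
  classical
  induction X using WellFoundedGT.induction with
  | ind X ih =>
    have h1 := sum_Icc_whitneyCoeff X
    have h2 : ∑ Y ∈ Finset.Icc X ⊤, A.muTop Y = if X = ⊤ then 1 else 0 := by
      convert IncidenceAlgebra.sum_Icc_mu_left (𝕜 := ℤ) X (⊤ : A.AugLattice)
      rfl
    rw [Finset.Icc_eq_cons_Ioc le_top, Finset.sum_cons] at h1 h2
    rw [Finset.sum_congr rfl fun Y hY => ih Y (Finset.mem_Ioc.1 hY).1] at h2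
    linarith

theorem realInf_val (S : Finset (Fin t)) :
    (A.realInf S).1 = ⊤ ⊓ S.inf fun k => LinearMap.ker (A.imForm k) :=
  top_inf_eq _ |>.symm

/-- The sign of μ is the parity of the codimension: all S with intersection X carry the same
dimension sign, and the signed sum is a nonnegative Whitney sum. -/
theorem natAbs_muTop (X : A.AugLattice) :
    ((A.muTop X).natAbs : ℤ) =
      (-1) ^ (finrank ℝ (⊤ : Submodule ℝ (Fin d → ℂ)) + finrank ℝ X.1) * A.muTop X := by
  classical
  have h := RealArrangement.whitneySum_nonneg A.imForm Finset.univ ⊤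
    (g := fun Y => if Y = X.1 then 1 else 0) fun Y => by split_ifs <;> simp
  have h1 : RealArrangement.whitneySum A.imForm Finset.univ ⊤
      (fun Y => if Y = X.1 then 1 else 0) =
      (-1) ^ (finrank ℝ (⊤ : Submodule ℝ (Fin d → ℂ)) + finrank ℝ X.1) * A.muTop X := by
    rw [muTop_eq_whitneyCoeff, whitneyCoeff, RealArrangement.whitneySum, Finset.powerset_univ,
      Finset.mul_sum]
    refine Finset.sum_congr rfl fun S _ => ?_
    rw [← realInf_val]
    by_cases hS : A.realInf S = X
    · rw [if_pos hS, if_pos (congrArg Subtype.val hS), hS]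
      ring
    · rw [if_neg hS, if_neg fun h => hS (Subtype.ext h), mul_zero, mul_zero]
  rw [← h1, ← abs_of_nonneg h, h1, abs_mul, abs_pow, abs_neg, abs_one, one_pow, one_mul,
    Int.natCast_natAbs]

open Classical in
/-- The number of chambers of the localization at `X`, by the Möbius function. -/
theorem chamberCount_eq_sum_natAbs_muTop (X : A.AugLattice) :
    RealArrangement.chamberCount A.imForm
        (Finset.univ.filter fun k => X.1 ≤ A.realHyperplane k) ⊤ =
      ∑ Y with X ≤ Y, ((A.muTop Y).natAbs : ℤ) := by
  rw [RealArrangement.chamberCount_eq_whitneySum, RealArrangement.whitneySum]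
  rw [Finset.sum_congr rfl fun Y _ => natAbs_muTop Y]
  simp only [muTop_eq_whitneyCoeff, whitneyCoeff, Finset.mul_sum]
  rw [Finset.sum_comm]
  have h : (Finset.univ.filter fun k => X.1 ≤ A.realHyperplane k).powerset =
      Finset.univ.filter fun S => X ≤ A.realInf S := by
    ext S
    simp [le_realInf_iff, Finset.subset_iff]
  rw [h, Finset.sum_filter]
  refine Finset.sum_congr rfl fun S _ => ?_
  simp only [mul_ite, mul_zero, Finset.sum_ite_eq, Finset.mem_filter, Finset.mem_univ, true_and]
  refine if_congr Iff.rfl ?_ rfl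
  rw [← realInf_val]
  ring

open Classical in
/-- The maximal faces above `F` are the chambers of the localization at the span of `F`. -/
theorem card_act_eq_self (F : A.Face) :
    (((Finset.univ.filter fun C => act F C = C).card : ℕ) : ℤ) =
      RealArrangement.chamberCount A.imForm
        (Finset.univ.filter fun k => (A.span F).1 ≤ A.realHyperplane k) ⊤ := by
  simp only [span_le_realHyperplane_iff]
  set T : Finset (Fin t) := Finset.univ.filter fun k => (F.1 k).level ≤ 1 with hT
  rw [RealArrangement.chamberCount, ← Finset.sum_filter, Finset.sum_const, nsmul_one]
  congr 1
  -- Off T the face F already has level 2 and overrides C, so a fixed C is determined by its signs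
  -- on T.
  have hoff : ∀ C : A.MaxFace, act F C = C → ∀ k ∉ T, C.1.1 k = F.1 k := by
    intro C hC k hk
    have hFk : 2 ≤ (F.1 k).level := by simpa [hT, Nat.lt_iff_add_one_le] using hk
    conv_lhs => rw [← hC]
    exact CSign.comp_of_level_le ((CSign.level_le_two _).trans hFk)
  refine Finset.card_bij (fun C _ => T.filter fun k => C.1.1 k = CSign.i) ?_ ?_ ?_
  · intro C hC
    refine Finset.mem_filter.2 ⟨Finset.mem_powerset.2 (Finset.filter_subset _ _), ?_⟩
    obtain ⟨z, hz⟩ := C.1.2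
    refine ⟨z, Submodule.mem_top, fun k hk => ?_⟩
    have h1 : C.1.1 k = CSign.i ↔ 0 < A.imForm k z := by
      rw [← hz]
      exact CSign.ofComplex_eq_i_iff
    have h2 : A.imForm k z ≠ 0 := by
      intro h0
      have h3 : (C.1.1 k).level ≤ 1 := by
        rw [← hz]
        exact CSign.level_ofComplex_le_one_iff.2 h0
      rw [(isMax_iff _).1 C.2 k] at h3
      omega
    simp only [Finset.mem_filter, hk, true_and, h1]
    exact ⟨id, fun h => lt_of_le_of_ne (not_lt.1 h) h2⟩
  · intro C hC C' hC' h
    refine Subtype.ext (Subtype.ext (funext fun k => ?_))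
    by_cases hk : k ∈ T
    · refine CSign.eq_of_level_eq_two ((isMax_iff _).1 C.2 k) ((isMax_iff _).1 C'.2 k) ?_
      simpa [hk] using Finset.ext_iff.1 h k
    · rw [hoff C (Finset.mem_filter.1 hC).2 k hk, hoff C' (Finset.mem_filter.1 hC').2 k hk]
  · intro P hP
    obtain ⟨hPT, x, -, hx⟩ := Finset.mem_filter.1 hP
    rw [Finset.mem_powerset] at hPT
    -- Surjectivity: for any point x of the chamber, composing F with the face of x gives the
    -- preimage.
    let G : A.Face := ⟨A.sign x, x, rfl⟩
    have hG : ∀ k ∈ T, (G.1 k).level = 2 := by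
      intro k hk
      refine le_antisymm (CSign.level_le_two _) (not_lt.1 fun h => ?_)
      have h0 : A.imForm k x = 0 := CSign.level_ofComplex_le_one_iff.1 (Nat.le_of_lt_succ h)
      by_cases hkP : k ∈ P
      · exact ((hx k hk).1 hkP).ne' h0
      · exact ((hx k hk).2 hkP).ne h0
    have hmax : IsMax (A.faceComp F G) := by
      refine (isMax_iff _).2 fun k => ?_
      rw [level_faceComp]
      by_cases hk : k ∈ T
      · rw [hG k hk]
        exact max_eq_right (CSign.level_le_two _)
      · have hFk : 2 ≤ (F.1 k).level := by simpa [hT, Nat.lt_iff_add_one_le] using hk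
        exact le_antisymm (max_le (CSign.level_le_two _) (CSign.level_le_two _))
          (hFk.trans (le_max_left _ _))
    refine ⟨⟨A.faceComp F G, hmax⟩, Finset.mem_filter.2 ⟨Finset.mem_univ _, Subtype.ext ?_⟩, ?_⟩
    · change A.faceComp F (A.faceComp F G) = A.faceComp F G
      rw [← faceComp_assoc, faceComp_eq_left le_rfl]
    · ext k
      rw [Finset.mem_filter]
      have hk : k ∈ T → (A.faceComp F G).1 k = G.1 k := fun hk =>
        CSign.comp_of_level_lt (by
          rw [hG k hk]
          exact Nat.lt_succ_of_le (by simpa [hT] using hk))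
      constructor
      · rintro ⟨hkT, h⟩
        change (A.faceComp F G).1 k = CSign.i at h
        rw [hk hkT] at h
        by_contra hkP
        exact ((hx k hkT).2 hkP).not_gt (CSign.ofComplex_eq_i_iff.1 h)
      · intro hkP
        refine ⟨hPT hkP, (hk (hPT hkP)).trans ?_⟩
        exact CSign.ofComplex_eq_i_iff.2 ((hx k (hPT hkP)).1 hkP)

end CArrangement


/-! ### Traces, diagonalizability and the eigenvalue 1 -/

namespace CArrangement

open Polynomial

variable {d t : ℕ} {A : CArrangement d t}

/-- The matrix of the action of a face on the maximal faces. -/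
noncomputable def actMatrix (F : A.Face) : Matrix A.MaxFace A.MaxFace ℝ :=
  Matrix.of fun C D => if act F C = D then 1 else 0

theorem transition_eq_sum (w : A.Face → ℝ) :
    A.transition w = ∑ F, w F • actMatrix F := by
  ext C D
  simp only [transition, actMatrix, Matrix.of_apply, Matrix.sum_apply, Matrix.smul_apply,
    smul_eq_mul, mul_ite, mul_one, mul_zero]
  rw [← Finset.sum_filter]
  refine Finset.sum_congr (Finset.ext fun F => ?_) fun _ _ => rfl
  rw [Finset.mem_filter, Finset.mem_filter, Subtype.ext_iff, Subtype.ext_iff]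
  rfl

/-- Rows index the starting state, so the left factor acts first and the order of composition
reverses. -/
theorem actMatrix_mul (F G : A.Face) :
    actMatrix F * actMatrix G = actMatrix (A.faceComp G F) := by
  ext C D
  simp only [actMatrix, Matrix.mul_apply, Matrix.of_apply, ite_mul, one_mul, zero_mul,
    Finset.sum_ite_eq, Finset.mem_univ, if_true, act_act]

theorem actMatrix_zeroFace : actMatrix A.zeroFace = 1 := by
  ext C D
  simp [actMatrix, zeroFace_act, Matrix.one_apply]

open Classical in
theorem trace_actMatrix (F : A.Face) :
    (actMatrix F).trace = ∑ Y with A.span F ≤ Y, ((A.muTop Y).natAbs : ℝ) := by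
  have h : ((Finset.univ.filter fun C => act F C = C).card : ℤ) =
      ∑ Y with A.span F ≤ Y, ((A.muTop Y).natAbs : ℤ) :=
    by convert (card_act_eq_self F).trans (chamberCount_eq_sum_natAbs_muTop _)
  have h' : ((Finset.univ.filter fun C => act F C = C).card : ℝ) =
      ∑ Y with A.span F ≤ Y, ((A.muTop Y).natAbs : ℝ) := by
    exact_mod_cast congrArg (Int.cast : ℤ → ℝ) h
  rw [← h']
  simp [Matrix.trace, actMatrix]

theorem trace_transition (w : A.Face → ℝ) :
    (A.transition w).trace = ∑ X, ((A.muTop X).natAbs : ℝ) * A.eps w X := by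
  classical
  simp only [transition_eq_sum, Matrix.trace_sum, Matrix.trace_smul, trace_actMatrix, eps,
    smul_eq_mul, Finset.mul_sum, Finset.sum_filter]
  rw [Finset.sum_comm]
  refine Finset.sum_congr rfl fun X _ => Finset.sum_congr rfl fun F _ => ?_
  split_ifs <;> ring

/-- The weights of the composition of two independent random faces. -/
noncomputable def convolve (v w : A.Face → ℝ) (H : A.Face) : ℝ :=
  ∑ F, ∑ G, if A.faceComp G F = H then v F * w G else 0

theorem transition_mul (v w : A.Face → ℝ) :
    A.transition v * A.transition w = A.transition (convolve v w) := by
  have h : A.transition (convolve v w) = ∑ H, ∑ F, ∑ G,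
      if A.faceComp G F = H then (v F * w G) • actMatrix H else 0 := by
    simp only [transition_eq_sum, convolve, Finset.sum_smul, ite_smul, zero_smul]
  rw [h, Finset.sum_comm, transition_eq_sum, transition_eq_sum, Finset.sum_mul_sum]
  refine Finset.sum_congr rfl fun F _ => ?_
  rw [Finset.sum_comm]
  refine Finset.sum_congr rfl fun G _ => ?_
  rw [Finset.sum_ite_eq, if_pos (Finset.mem_univ _), smul_mul_smul_comm, actMatrix_mul]

theorem eps_convolve (v w : A.Face → ℝ) (X : A.AugLattice) :
    A.eps (convolve v w) X = A.eps v X * A.eps w X := by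
  classical
  simp only [eps, Finset.sum_filter, convolve]
  calc _ = ∑ H, ∑ F, ∑ G, if A.faceComp G F = H then
        (if A.span H ≤ X then v F * w G else 0) else 0 := by
        refine Finset.sum_congr rfl fun H _ => ?_
        split_ifs <;> simp
    _ = ∑ F, ∑ G, if A.span (A.faceComp G F) ≤ X then v F * w G else 0 := by
        rw [Finset.sum_comm]
        refine Finset.sum_congr rfl fun F _ => ?_
        rw [Finset.sum_comm]
        exact Finset.sum_congr rfl fun G _ => by rw [Finset.sum_ite_eq, if_pos (Finset.mem_univ _)]
    _ = _ := by
        rw [Finset.sum_mul_sum]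
        refine Finset.sum_congr rfl fun F _ => Finset.sum_congr rfl fun G _ => ?_
        simp only [span_faceComp_le_iff]
        by_cases h1 : A.span F ≤ X <;> by_cases h2 : A.span G ≤ X <;> simp [h1, h2]

/-- The weight v is the k-fold convolution, starting for k = 0 from the point mass at the identity
`zeroFace`. -/
theorem exists_transition_pow (w : A.Face → ℝ) (k : ℕ) :
    ∃ v : A.Face → ℝ, A.transition w ^ k = A.transition v ∧
      ∀ X, A.eps v X = A.eps w X ^ k := by
  classical
  induction k with
  | zero =>
    refine ⟨Pi.single A.zeroFace 1, ?_, fun X => ?_⟩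
    · rw [pow_zero, transition_eq_sum, Finset.sum_eq_single A.zeroFace, Pi.single_eq_same,
        one_smul, actMatrix_zeroFace]
      · intro F _ hF
        rw [Pi.single_eq_of_ne hF, zero_smul]
      · simp
    · rw [pow_zero, eps, Finset.sum_eq_single A.zeroFace, Pi.single_eq_same]
      · intro F _ hF
        rw [Pi.single_eq_of_ne hF]
      · intro h
        have h0 : A.span A.zeroFace ≤ X := span_le_iff.2
          ⟨fun k _ => level_zeroFace k, fun k _ => (level_zeroFace k).le.trans zero_le_one⟩
        simp [h0] at h
  | succ k ih =>
    obtain ⟨v, hv, hv'⟩ := ih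
    exact ⟨convolve v w, by rw [pow_succ, hv, transition_mul],
      fun X => by rw [eps_convolve, hv', pow_succ]⟩

theorem trace_transition_pow (w : A.Face → ℝ) (k : ℕ) :
    (A.transition w ^ k).trace = ∑ X, ((A.muTop X).natAbs : ℝ) * A.eps w X ^ k := by
  obtain ⟨v, hv, hv'⟩ := exists_transition_pow w k
  simp only [hv, trace_transition, hv']

theorem eps_lt_eps {w : A.Face → ℝ} (hw : ∀ F, 0 ≤ w F) {X Y : A.AugLattice} (hXY : X ≤ Y)
    {G : A.Face} (hG : w G ≠ 0) (hGX : ¬ A.span G ≤ X) (hGY : A.span G ≤ Y) :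
    A.eps w X < A.eps w Y := by
  classical
  refine Finset.sum_lt_sum_of_subset (i := G) (fun F hF => ?_) ?_ ?_ ?_ fun F _ _ => hw F
  · rw [Finset.mem_filter] at hF ⊢
    exact ⟨hF.1, hF.2.trans hXY⟩
  · simpa using hGY
  · simpa using hGX
  · exact lt_of_le_of_ne (hw G) hG.symm

theorem transition_mul_actMatrix (w : A.Face → ℝ) (F : A.Face) :
    A.transition w * actMatrix F = ∑ G, w G • actMatrix (A.faceComp F G) := by
  rw [transition_eq_sum, Finset.sum_mul]
  exact Finset.sum_congr rfl fun G _ => by rw [Matrix.smul_mul, actMatrix_mul]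

open Classical in
-- Faces G absorbed by F contribute exactly ε_{span F} times the matrix of F.
theorem transition_sub_eps_mul_actMatrix (w : A.Face → ℝ) (F : A.Face) :
    (A.transition w - algebraMap ℝ _ (A.eps w (A.span F))) * actMatrix F =
      ∑ G with ¬ A.span G ≤ A.span F, w G • actMatrix (A.faceComp F G) := by
  rw [sub_mul, transition_mul_actMatrix, Algebra.algebraMap_eq_smul_one, Matrix.smul_mul,
    Matrix.one_mul, eps, Finset.sum_smul, sub_eq_iff_eq_add, add_comm,
    ← Finset.sum_filter_add_sum_filter_not Finset.univ fun G => A.span G ≤ A.span F]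
  congr 1
  exact Finset.sum_congr rfl fun G hG => by rw [faceComp_eq_left (Finset.mem_filter.1 hG).2]

open Classical in
theorem aeval_transition_mul_actMatrix_eq_zero {w : A.Face → ℝ} (hw : ∀ F, 0 ≤ w F)
    (s : Finset ℝ) (hs : ∀ X, A.eps w X ∈ s) (F : A.Face) :
    aeval (A.transition w) (∏ a ∈ s with A.eps w (A.span F) ≤ a, (X - C a)) * actMatrix F = 0 := by
  -- Each surviving F∘G of nonzero weight has larger ε, hence fewer values of s at or above it; its
  -- annihilating product divides the one left after removing a factor.
  induction hn : (s.filter fun a => A.eps w (A.span F) ≤ a).card using Nat.strong_induction_on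
    generalizing F with
  | _ n ih =>
    have h1 : (s.filter fun a => A.eps w (A.span F) ≤ a) =
        insert (A.eps w (A.span F)) (s.filter fun a => A.eps w (A.span F) < a) := by
      ext a
      simp only [Finset.mem_filter, Finset.mem_insert, le_iff_eq_or_lt]
      constructor
      · rintro ⟨h, h' | h'⟩
        · exact Or.inl h'.symm
        · exact Or.inr ⟨h, h'⟩
      · rintro (rfl | ⟨h, h'⟩)
        · exact ⟨hs _, Or.inl rfl⟩
        · exact ⟨h, Or.inr h'⟩
    have h2 : A.eps w (A.span F) ∉ s.filter fun a => A.eps w (A.span F) < a := by simp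
    rw [h1, Finset.prod_insert h2, mul_comm, map_mul, Matrix.mul_assoc, map_sub, aeval_X, aeval_C,
      transition_sub_eps_mul_actMatrix, Finset.mul_sum]
    refine Finset.sum_eq_zero fun G hG => ?_
    rw [Matrix.mul_smul]
    by_cases hG0 : w G = 0
    · rw [hG0, zero_smul]
    have h3 := (span_faceComp_le_iff (F := F) (G := G)).1 le_rfl
    have h4 := eps_lt_eps hw h3.1 hG0 (Finset.mem_filter.1 hG).2 h3.2
    have h5 : (s.filter fun a => A.eps w (A.span (A.faceComp F G)) ≤ a) ⊆
        s.filter fun a => A.eps w (A.span F) < a :=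
      Finset.monotone_filter_right _ fun a _ ha => h4.trans_le ha
    have h6 := ih _ (by
      rw [← hn, h1, Finset.card_insert_of_notMem h2]
      exact Nat.lt_succ_of_le (Finset.card_le_card h5)) (A.faceComp F G) rfl
    rw [← Finset.prod_sdiff h5, map_mul, Matrix.mul_assoc, h6, Matrix.mul_zero, smul_zero]

theorem exists_transition_eq_conj_diagonal {w : A.Face → ℝ} (hw : ∀ F, 0 ≤ w F) :
    ∃ (Q : (Matrix A.MaxFace A.MaxFace ℝ)ˣ) (D : A.MaxFace → ℝ),
      A.transition w = (Q : Matrix A.MaxFace A.MaxFace ℝ) * Matrix.diagonal D *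
        ((Q⁻¹ : (Matrix A.MaxFace A.MaxFace ℝ)ˣ) : Matrix A.MaxFace A.MaxFace ℝ) := by
  classical
  let s : Finset ℝ := Finset.univ.image (A.eps w)
  -- The zero face acts as the identity, so the polynomial annihilates the transition matrix itself.
  have h := aeval_transition_mul_actMatrix_eq_zero hw s (by simp [s]) A.zeroFace
  rw [actMatrix_zeroFace, Matrix.mul_one] at h
  exact Matrix.exists_eq_conj_diagonal_of_aeval_prod_eq_zero _ _ h

theorem eps_top (w : A.Face → ℝ) : A.eps w ⊤ = ∑ F, w F := by
  classical
  rw [eps, Finset.filter_true_of_mem fun _ _ => le_top]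

theorem sum_transition (w : A.Face → ℝ) (C : A.MaxFace) :
    ∑ D, A.transition w C D = ∑ F, w F := by
  simp only [transition_eq_sum, Matrix.sum_apply, Matrix.smul_apply, actMatrix, Matrix.of_apply,
    smul_eq_mul, mul_ite, mul_one, mul_zero]
  rw [Finset.sum_comm]
  simp

theorem eps_lt_one {w : A.Face → ℝ} (hw : w ∈ stdSimplex ℝ A.Face)
    (hconc : ∀ k, ¬ A.ConcentratedOn w (A.realHyperplane k)) {X : A.AugLattice} (hX : X ≠ ⊤) :
    A.eps w X < 1 := by
  obtain ⟨k, hk⟩ := exists_le_realHyperplane hX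
  obtain ⟨F, hF, hFk⟩ : ∃ F, w F ≠ 0 ∧ ¬ A.cone F ⊆ A.realHyperplane k := by
    have h := hconc k
    unfold ConcentratedOn at h
    push Not at h
    exact h
  rw [← hw.2, ← eps_top]
  refine eps_lt_eps hw.1 le_top hF (fun h => hFk ?_) le_top
  rw [cone_subset_realHyperplane_iff, ← span_le_realHyperplane_iff]
  exact le_trans h hk

theorem muTop_top : A.muTop ⊤ = 1 :=
  IncidenceAlgebra.mu_self _

end CArrangement

theorem theorem4p10 {d t : ℕ} (A : CArrangement d t) (hA : A.Essential)
    (w : A.Face → ℝ) (hw : w ∈ stdSimplex ℝ A.Face) :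
    -- the transition matrix is diagonalizable over the reals
    (∃ (Q : (Matrix A.MaxFace A.MaxFace ℝ)ˣ) (D : A.MaxFace → ℝ),
      A.transition w = (Q : Matrix A.MaxFace A.MaxFace ℝ) * Matrix.diagonal D *
        ((Q⁻¹ : (Matrix A.MaxFace A.MaxFace ℝ)ˣ) : Matrix A.MaxFace A.MaxFace ℝ)) ∧
    -- each `ε_X` with `μ(X, 1̂) ≠ 0` is an eigenvalue
    (∀ X : A.AugLattice, A.muTop X ≠ 0 →
      Module.End.HasEigenvalue (Matrix.toLin' (A.transition w)) (A.eps w X)) ∧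
    -- `ε_X` has multiplicity `|μ(X, 1̂)|`, multiplicities adding up when values coincide
    (A.transition w).charpoly =
      ∏ X : A.AugLattice, (Polynomial.X - Polynomial.C (A.eps w X)) ^ (A.muTop X).natAbs ∧
    -- there are no other eigenvalues, not even complex ones
    (∀ c : ℂ, Module.End.HasEigenvalue
        (Matrix.toLin' ((A.transition w).map (fun r : ℝ => (r : ℂ)))) c →
      ∃ X : A.AugLattice, A.muTop X ≠ 0 ∧ c = (A.eps w X : ℂ)) ∧
    -- unique stationary distribution
    ((∀ k, ¬ A.ConcentratedOn w (A.realHyperplane k)) →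
      ∃! p : A.MaxFace → ℝ, p ∈ stdSimplex ℝ A.MaxFace ∧
        Matrix.vecMul p (A.transition w) = p) := by
  obtain ⟨Q, D, hQD⟩ := CArrangement.exists_transition_eq_conj_diagonal hw.1
  have hpow : ∀ k : ℕ, ∑ C, D C ^ k =
      ∑ X : A.AugLattice, ((A.muTop X).natAbs : ℝ) * A.eps w X ^ k := fun k => by
    rw [← CArrangement.trace_transition_pow, hQD, Matrix.trace_pow_conj_diagonal]
  have hchar : (A.transition w).charpoly =
      ∏ X : A.AugLattice, (Polynomial.X - Polynomial.C (A.eps w X)) ^ (A.muTop X).natAbs := by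
    rw [hQD, Matrix.coe_units_inv, Matrix.charpoly_units_conj, Matrix.charpoly_diagonal]
    exact Polynomial.prod_X_sub_C_eq_of_sum_pow_eq hpow
  refine ⟨⟨Q, D, hQD⟩, fun X hX => ?_, hchar, fun c hc => ?_, fun hconc => ?_⟩
  · rw [Module.End.hasEigenvalue_iff_isRoot_charpoly, Matrix.charpoly_toLin', hchar,
      Polynomial.isRoot_prod]
    refine ⟨X, Finset.mem_univ _, ?_⟩
    simp [Polynomial.IsRoot, hX]
  · rw [Module.End.hasEigenvalue_iff_isRoot_charpoly, Matrix.charpoly_toLin'] at hc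
    have h1 : ((A.transition w).map (fun r : ℝ => (r : ℂ))).charpoly =
        ((A.transition w).charpoly).map Complex.ofRealHom :=
      Matrix.charpoly_map (A.transition w) Complex.ofRealHom
    rw [h1, hchar, Polynomial.map_prod, Polynomial.isRoot_prod] at hc
    obtain ⟨X, -, hX⟩ := hc
    refine ⟨X, fun h0 => ?_, ?_⟩
    · simp [h0, Polynomial.IsRoot] at hX
    · simp only [Polynomial.IsRoot, Polynomial.map_pow, Polynomial.map_sub, Polynomial.map_X,
        Polynomial.map_C, Polynomial.eval_pow, Polynomial.eval_sub, Polynomial.eval_X,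
        Polynomial.eval_C] at hX
      exact sub_eq_zero.1 (eq_zero_of_pow_eq_zero hX)
  · have hfilter : (Finset.univ.filter fun X : A.AugLattice => A.eps w X = 1) = {⊤} := by
      ext X
      rw [Finset.mem_filter, Finset.mem_singleton]
      constructor
      · rintro ⟨-, h⟩
        by_contra hX
        exact (CArrangement.eps_lt_one hw hconc hX).ne h
      · rintro rfl
        exact ⟨Finset.mem_univ _, (CArrangement.eps_top w).trans hw.2⟩
    -- Only 1̂ contributes to the value 1, with weight |μ(1̂, 1̂)| = 1, so exactly one diagonal
    -- entry equals 1.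
    have hcard := card_filter_eq_sum_of_sum_pow_eq hpow 1
    rw [hfilter, Finset.sum_singleton, CArrangement.muTop_top, Int.natAbs_one,
      Finset.card_eq_one] at hcard
    obtain ⟨C, hC⟩ := hcard
    have hC' : ∀ B, D B = 1 ↔ B = C := fun B => by
      simpa using Finset.ext_iff.1 hC B
    exact Matrix.existsUnique_stationary_of_conj_diagonal Q D _ hQD
      (fun B B' => Finset.sum_nonneg fun F _ => hw.1 F)
      (fun B => (CArrangement.sum_transition w B).trans hw.2) C ((hC' C).2 rfl)
      fun B hB => (hC' B).1 hB
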